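/- Notation: for a subgroup $K$ and an element $x$ of a group, $K^x=xKx^{-1}$. A subgroup $H$ of a group $G$ is verbally closed if, for every word $w(x_1,\dots,x_m)$ in a free group on countably many variables and every $h\in H$, the equation $w(x_1,\dots,x_m)=h$ has a solution in $H$ whenever it has a solution in $G$. Theorem. Let $G=G_1*\dots*G_n$ be a free product of finite nontrivial groups, and let $H\le G$ be a subgroup with a Kurosh free decomposition $$H=F*\mathop{*}_{i=1}^{n}\Bigl(\mathop{*}_{j\in J_i}H_{i,j}^{g_{i,j}}\Bigr),$$ that is, $F\le G$ is a free group with $F\cap G_i^{g}=\{1\}$ for all $i$ and all $g\in G$, the $J_i$ are (possibly empty or infinite) index sets, each $H_{i,j}\neq\{1\}$ is a subgroup of $G_i$, $g_{i,j}\in G$, and $H$ is the free product of its subgroups $F$ and $H_{i,j}^{g_{i,j}}$. If $H$ is verbally closed in $G$, then: 1. $F$ is the trivial group. 2. For every $i$ and any two distinct indices $j_1\neq j_2$ in $J_i$: if $f,x\in G_i$ and $k_1,k_2\in\mathbb N$ satisfy $f^{k_1}\in H_{i,j_1}$ and $f^{k_2}\in H_{i,j_2}^{x}$, then $f^{k_1}=1$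 or $f^{k_2}=1$. -/

import Mathlib

/-- The subgroup `H` is verbally closed: whenever an equation `w(x₀, x₁, …) = h`, with `w` a word
in the free group on countably many variables and right-hand side `h ∈ H`, has a solution in the
whole group, it has a solution in `H`. -/
def IsVerballyClosed {P : Type*} [Group P] (H : Subgroup P) : Prop :=
  ∀ (w : FreeGroup ℕ), ∀ h ∈ H,
    (∃ x : ℕ → P, FreeGroup.lift x w = h) →
      ∃ y : ℕ → P, (∀ k, y k ∈ H) ∧ FreeGroup.lift y w = h

/-- The conjugate `K^g = g K g⁻¹` of a subgroup. -/
def conjBy {P : Type*} [Group P] (K : Subgroup P) (g : P) : Subgroup P :=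
  K.map (MulAut.conj g).toMonoidHom

/-- The subgroup `H` is the (internal) free product of the family of subgroups `B`: the canonical
homomorphism from the external free product of the `B k` to the ambient group is injective with
image `H`. -/
def IsInternalFreeProduct {P : Type*} [Group P] {κ : Type*} (H : Subgroup P)
    (B : κ → Subgroup P) : Prop :=
  Function.Injective (Monoid.CoprodI.lift fun k => (B k).subtype) ∧
    (Monoid.CoprodI.lift fun k => (B k).subtype).range = H

/-- A Kurosh free decomposition `H = F ∗ ∗_{i, j} (K i j)^(g i j)` of a subgroup `H` of the free
product of the groups `G i`: the subgroup `F` is free and meets every conjugate of every `G i`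
trivially, the `K i j` are subgroups of `G i`, the `g i j` are elements of the free product, and
`H` is the internal free product of `F` and of all the conjugates `(K i j)^(g i j)`. -/
structure IsKuroshDecomposition {ι : Type*} {G : ι → Type*} [∀ i, Group (G i)]
    (H F : Subgroup (Monoid.CoprodI G)) {J : ι → Type*}
    (K : ∀ i, J i → Subgroup (G i)) (g : ∀ i, J i → Monoid.CoprodI G) : Prop where
  free : IsFreeGroup F
  inter_conj : ∀ (i : ι) (x : Monoid.CoprodI G),
    F ⊓ conjBy (Monoid.CoprodI.of : G i →* Monoid.CoprodI G).range x = ⊥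
  freeProduct : IsInternalFreeProduct H
    (fun o : Option (Σ i, J i) =>
      o.elim F fun p => conjBy ((K p.1 p.2).map Monoid.CoprodI.of) (g p.1 p.2))

/-!
Verbal closedness is used in two ways.

For homomorphisms to a commutative group it gives `IsVerballyClosed.hom_eq_one_of_mem_commutator`:
an element `h` of the verbally closed subgroup `H` that is a product of commutators in the whole
group `P` is one in `H`. If `F` is a nontrivial free factor of `H`, then `H` maps onto `ℤ` through
`F`; but `P`, being generated by finitely many finite groups, has an abelianization of finite
exponent, so that a power of any `t` in `F` is a product of commutators, a contradiction.

For homomorphisms to certain finite groups it gives `IsVerballyClosed.exists_extension`: a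
surjection `π` from `H` onto a finite group `Q`, in which commuting normal subgroups are never both
nontrivial, extends to `P`. Indeed, present `P` as a quotient of a free group of finite rank, and
let `E` be the preimage of `H` and `θ : E → Q` the composite with `π`. By verbal closedness, each
`w` in `E` satisfies `φ w = θ w` for one of the finitely many homomorphisms `φ` from the free group
to `Q`. Because of the condition on `Q`, some `w` outside the kernel of `θ` is killed by each `φ`
whose kernel in `E` is not contained in that of `θ`. The `φ` which belongs to this `w` then agrees
with `θ` on `E` up to an automorphism of `Q`, and so it may be taken to extend `θ`; it kills the
relators of `P`.

A transitive permutation group of prime degree is such a `Q` if it has a nontrivial element with two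
fixed points (`exists_not_commute_conj_of_prime_card`). So suppose that `A` and `B` are two finite
free factors of `H`, and let `H` act on a finite set through actions of `A` and of `B`, chosen at
will and glued together transitively (`GluedAction.exists_perm_homs`), the other factors acting
trivially. When the degree is prime and `a` in `A` is nontrivial with two fixed points, this
extends to an action of `P`, which restricts the relations in `P` between `a` and
elements `b` of `B`. The action of `B` is free up to one fixed
point, and that of `A` consists of `s` copies of a transitive `A`-set `X` on which `a` acts freely
and of fixed points; Dirichlet's theorem provides `s` for which the degree
`1 + s (|X| - 1) |B|` is prime.

* With `X = A` the elements `a` and `b` have different numbers of fixed points, so that they are not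
  conjugate in `P` (`IsVerballyClosed.not_isConj_of_ne`; for `|A| = |B| = 2`, the one case where
  there is no room for this, commutators suffice).
* If `a` and `b` have prime orders `p ≠ q`, let `X` be the set of cosets of a Sylow `q`-subgroup of
  `A`. The number of fixed points of `a` is not `1` modulo `q`, as it would be if `a` commuted with
  a conjugate of `b` (`IsVerballyClosed.not_commute_conj_of_ne`).

If now powers of `f` contradict the second assertion, then further powers of them have prime orders
`p` and `q`. For `p = q` they generate the same subgroup, which contradicts the first item, and for
`p ≠ q` they commute, which contradicts the second.
-/

/-! ### Homomorphisms from a verbally closed subgroup -/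

open scoped commutatorElement

/-- A finite set of homomorphisms, each of which kills an element outside the kernel of a
surjection `θ`, has a common kernel that is not contained in the kernel of `θ`, provided that in the
target of `θ` any two nontrivial elements fail to commute after conjugating one of them. -/
theorem MonoidHom.exists_forall_eq_one {E Q Q' : Type*} [Group E] [Group Q] [Group Q']
    (hQ : ∀ a b : Q, a ≠ 1 → b ≠ 1 → ∃ g, ¬ Commute a (g * b * g⁻¹)) [Nontrivial Q]
    {θ : E →* Q} (hθ : Function.Surjective θ) (S : Set (E →* Q')) (hS : S.Finite)
    (h : ∀ φ ∈ S, ∃ e, φ e = 1 ∧ θ e ≠ 1) : ∃ e, (∀ φ ∈ S, φ e = 1) ∧ θ e ≠ 1 := by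
  induction S, hS using Set.Finite.induction_on with
  | empty =>
    obtain ⟨q, hq⟩ := exists_ne (1 : Q)
    obtain ⟨e, rfl⟩ := hθ q
    exact ⟨e, by simp, hq⟩
  | @insert φ S _ _ ih =>
    obtain ⟨e₁, h₁, h₁'⟩ := ih fun φ' h' => h φ' (Set.mem_insert_of_mem _ h')
    obtain ⟨e₂, h₂, h₂'⟩ := h φ (Set.mem_insert _ _)
    obtain ⟨g, hg⟩ := hQ _ _ h₁' h₂'
    obtain ⟨c, rfl⟩ := hθ g
    refine ⟨⁅e₁, c * e₂ * c⁻¹⁆, ?_, ?_⟩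
    · rintro ψ (rfl | hψ)
      · simp [map_commutatorElement, h₂]
      · simp [map_commutatorElement, h₁ ψ hψ]
    · rw [map_commutatorElement, Ne, commutatorElement_eq_one_iff_commute]
      simpa using hg

namespace IsVerballyClosed

variable {P : Type*} [Group P] {H : Subgroup P}

/-- If the value `x w` of a word `w` lies in the verbally closed subgroup, then some homomorphism to
the subgroup takes the same value on `w`. It need not agree with `x` on other words. -/
theorem exists_hom_eq (hH : IsVerballyClosed H) {α : Type*} [Countable α] (x : FreeGroup α →* P)
    (w : FreeGroup α) (hw : x w ∈ H) : ∃ ψ : FreeGroup α →* H, (ψ w : P) = x w := by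
  obtain ⟨f, hf⟩ := exists_injective_nat α
  have hx : (FreeGroup.lift (Function.extend f (fun i => x (FreeGroup.of i)) 1)).comp
      (FreeGroup.map f) = x := by
    ext i
    simp [hf.extend_apply]
  obtain ⟨y, hy, hyw⟩ := hH (FreeGroup.map f w) (x w) hw ⟨_, DFunLike.congr_fun hx w⟩
  refine ⟨FreeGroup.lift fun i => ⟨y (f i), hy (f i)⟩, ?_⟩
  rw [← hyw]
  have : H.subtype.comp (FreeGroup.lift fun i => (⟨y (f i), hy (f i)⟩ : H)) =
      (FreeGroup.lift y).comp (FreeGroup.map f) := by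
    ext i
    simp
  exact DFunLike.congr_fun this w

/-- A verbally closed subgroup contains no product of commutators of the whole group that is visible
in its own abelianization. -/
theorem hom_eq_one_of_mem_commutator [Group.FG P] (hH : IsVerballyClosed H) {M : Type*}
    [CommGroup M] (π : H →* M) (h : H) (hh : (h : P) ∈ commutator P) : π h = 1 := by
  obtain ⟨α, _, x, hx⟩ := Group.fg_iff_exists_freeGroup_hom_surjective_finite.1 ‹Group.FG P›
  have hmap : (commutator (FreeGroup α)).map x = commutator P := by
    rw [commutator_def, commutator_def, Subgroup.map_commutator,
      Subgroup.map_top_of_surjective x hx]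
  rw [← hmap] at hh
  obtain ⟨w, hw, hwh⟩ := hh
  obtain ⟨ψ, hψ⟩ := hH.exists_hom_eq x w (hwh ▸ h.2)
  have hψ' : ψ w = h := Subtype.ext (hψ.trans hwh)
  rw [← hψ']
  exact Abelianization.commutator_subset_ker (π.comp ψ) hw

/-- A surjection from a verbally closed subgroup of a finitely generated group onto a finite group
`Q` extends to the whole group, provided that any two nontrivial elements of `Q` fail to commute
after conjugating one of them (equivalently, `Q` has a unique minimal normal subgroup and it is not
abelian, or `Q = 1`). -/
theorem exists_extension [Group.FG P] (hH : IsVerballyClosed H) {Q : Type*} [Group Q] [Finite Q]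
    (hQ : ∀ a b : Q, a ≠ 1 → b ≠ 1 → ∃ g, ¬ Commute a (g * b * g⁻¹))
    (π : H →* Q) (hπ : Function.Surjective π) : ∃ Φ : P →* Q, ∀ h : H, Φ h = π h := by
  rcases subsingleton_or_nontrivial Q with hsub | hnt
  · exact ⟨1, fun _ => Subsingleton.elim _ _⟩
  obtain ⟨α, _, x, hx⟩ := Group.fg_iff_exists_freeGroup_hom_surjective_finite.1 ‹Group.FG P›
  -- `E` is the group of words whose value lies in `H`, and `θ` is their value in `Q`.
  let E : Subgroup (FreeGroup α) := H.comap x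
  let x' : E →* H := x.subgroupComap H
  have hx' : Function.Surjective x' := fun h => by
    obtain ⟨w, hw⟩ := hx h
    exact ⟨⟨w, show x w ∈ H from hw ▸ h.2⟩, Subtype.ext hw⟩
  let θ : E →* Q := π.comp x'
  have hθ : Function.Surjective θ := hπ.comp hx'
  have : Finite (FreeGroup α →* Q) := Finite.of_equiv _ FreeGroup.lift
  let S : Set (E →* Q) := {φ | (∃ ψ : FreeGroup α →* Q, φ = ψ.comp E.subtype) ∧
    ∃ e, φ e = 1 ∧ θ e ≠ 1}
  have hS : S.Finite := (Set.finite_range fun ψ : FreeGroup α →* Q =>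
    ψ.comp E.subtype).subset fun φ hφ => hφ.1.imp fun _ h => h.symm
  obtain ⟨e, he, hθe⟩ := MonoidHom.exists_forall_eq_one hQ hθ S hS fun φ hφ => hφ.2
  obtain ⟨ψ, hψ⟩ := hH.exists_hom_eq x e e.2
  set φ : FreeGroup α →* Q := π.comp ψ with hφ
  have hφe : φ e = θ e := congrArg π (Subtype.ext hψ)
  have hker : ∀ w : E, φ w = 1 → θ w = 1 := by
    by_contra! hcon
    exact hθe (hφe ▸ he (φ.comp E.subtype) ⟨⟨φ, rfl⟩, hcon⟩)
  -- The kernel of `φ` on `E` is contained in that of `θ`, so that `φ` maps `E` onto the finite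
  -- group `Q`, and `θ` is `φ` followed by an endomorphism of `Q`.
  have hsurj : Function.Surjective (φ.comp E.subtype) := by
    have hinj : Function.Injective fun q : Q => φ (Function.surjInv hθ q : E) := by
      intro q q' h
      have := hker ((Function.surjInv hθ q)⁻¹ * Function.surjInv hθ q') (by
        simpa [inv_mul_eq_one] using h)
      rwa [map_mul, map_inv, Function.surjInv_eq hθ, Function.surjInv_eq hθ, inv_mul_eq_one] at this
    intro q
    obtain ⟨q', hq'⟩ := Finite.surjective_of_injective hinj q
    exact ⟨_, hq'⟩
  let β : Q →* Q := (φ.comp E.subtype).liftOfSurjective hsurj ⟨θ, hker⟩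
  have hβ : ∀ w : E, β (φ w) = θ w := fun w =>
    MonoidHom.liftOfRightInverse_comp_apply (φ.comp E.subtype) _ _ ⟨θ, hker⟩ w
  have hkx : x.ker ≤ (β.comp φ).ker := by
    intro w hw
    have hw' : x w = 1 := hw
    have := hβ ⟨w, show x w ∈ H from hw' ▸ H.one_mem⟩
    rw [MonoidHom.mem_ker, MonoidHom.comp_apply, this]
    exact (congrArg π (Subtype.ext hw')).trans π.map_one
  refine ⟨x.liftOfSurjective hx ⟨β.comp φ, hkx⟩, fun h => ?_⟩
  obtain ⟨w, rfl⟩ := hx' h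
  exact (MonoidHom.liftOfRightInverse_comp_apply x _ _ ⟨β.comp φ, hkx⟩ w).trans (hβ w)

end IsVerballyClosed

/-! ### Transitive permutation groups of prime degree -/

open MulAction in
/-- In a permutation group of prime degree, an element with two fixed points forces commuting
nontrivial normal subgroups apart: otherwise both of them would be regular of prime order, hence
generated by any element that moves one of the fixed points to the other, and such an element
commutes with the given one. -/
theorem exists_not_commute_conj_of_prime_card {Q Ω : Type*} [Group Q] [MulAction Q Ω]
    [FaithfulSMul Q Ω] [IsPretransitive Q Ω] (hΩ : (Nat.card Ω).Prime) {c : Q} (hc : c ≠ 1)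
    {x y : Ω} (hxy : x ≠ y) (hx : c • x = x) (hy : c • y = y) (a b : Q) (ha : a ≠ 1) (hb : b ≠ 1) :
    ∃ g, ¬ Commute a (g * b * g⁻¹) := by
  by_contra! hcomm
  have hprim : IsPreprimitive Q Ω := IsPreprimitive.of_prime_card hΩ
  have htrans : ∀ b : Q, b ≠ 1 → IsPretransitive (Subgroup.normalClosure {b}) Ω := by
    intro b hb
    refine IsQuasiPreprimitive.isPretransitive_of_normal (G := Q) fun htop => hb ?_
    refine eq_of_smul_eq_smul (α := Ω) fun z => ?_
    have hz : z ∈ fixedPoints (Subgroup.normalClosure {b}) Ω := htop ▸ Set.mem_univ z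
    rw [one_smul]
    exact hz ⟨b, Subgroup.subset_normalClosure rfl⟩
  set N := Subgroup.normalClosure {a}
  have hN := htrans a ha
  have hNb := htrans b hb
  have hNN : ∀ n ∈ N, ∀ k ∈ Subgroup.normalClosure {b}, Commute n k := by
    have h1 : N ≤ Subgroup.centralizer (Subgroup.normalClosure {b} : Subgroup Q) := by
      refine Subgroup.normalClosure_le_normal ?_
      rw [Set.singleton_subset_iff, SetLike.mem_coe, Subgroup.mem_centralizer_iff]
      intro k hk
      rw [SetLike.mem_coe, Subgroup.normalClosure] at hk
      refine (?_ : Commute k a)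
      induction hk using Subgroup.closure_induction with
      | mem k hk =>
        obtain ⟨b', hb', hconj⟩ := Group.mem_conjugatesOfSet_iff.1 hk
        obtain ⟨g, rfl⟩ := isConj_iff.1 hconj
        rw [Set.mem_singleton_iff.1 hb']
        exact (hcomm g).symm
      | one => exact Commute.one_left a
      | mul k l _ _ hk hl => exact hk.mul_left hl
      | inv k _ hk => exact hk.inv_left
    intro n hn k hk
    exact (Subgroup.mem_centralizer_iff.1 (h1 hn) k hk).symm
  -- `N` commutes with a transitive group, hence acts freely.
  have hfree : ∀ n ∈ N, ∀ z : Ω, n • z = z → n = 1 := by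
    intro n hn z hz
    refine eq_of_smul_eq_smul (α := Ω) fun z' => ?_
    obtain ⟨k, rfl⟩ := exists_smul_eq (Subgroup.normalClosure {b}) z z'
    rw [Subgroup.smul_def, smul_smul, (hNN n hn k k.2).eq, mul_smul, hz, one_smul]
  have hcardN : Nat.card N = Nat.card Ω := by
    refine Nat.card_eq_of_bijective (fun n : N => n • x) ⟨fun n n' h => ?_, exists_smul_eq N x⟩
    have := hfree (n⁻¹ * n' : N) (n⁻¹ * n' : N).2 x (by
      rw [← Subgroup.smul_def, mul_smul, ← (show n • x = n' • x from h), inv_smul_smul])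
    exact inv_mul_eq_one.1 (Subtype.ext this)
  obtain ⟨n, hn⟩ := exists_smul_eq N x y
  have hcn : Commute c n := by
    have h1 := hfree ((n : Q)⁻¹ * (c * n * c⁻¹))
      (N.mul_mem (N.inv_mem n.2) (Subgroup.normalClosure_normal.conj_mem _ n.2 c)) x (by
        have hcx : c⁻¹ • x = x := inv_smul_eq_iff.2 hx.symm
        rw [mul_smul, mul_smul, hcx, mul_smul, ← Subgroup.smul_def, hn, hy, ← hn,
          Subgroup.smul_def, inv_smul_smul])
    exact (mul_inv_eq_iff_eq_mul.1 (inv_mul_eq_one.1 h1).symm)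
  have hn1 : n ≠ 1 := by
    rintro rfl
    exact hxy (by rw [← hn, one_smul])
  refine hc (eq_of_smul_eq_smul (α := Ω) fun z => ?_)
  obtain ⟨k, rfl⟩ := exists_smul_eq N x z
  have := Fact.mk hΩ
  obtain ⟨l, rfl⟩ := mem_zpowers_of_prime_card hcardN hn1 (g' := k)
  have hl : Commute c ((n ^ l : N) : Q) := by simpa using hcn.zpow_right l
  rw [Subgroup.smul_def, smul_smul, hl.eq, mul_smul, hx, one_smul]

/-! ### Gluing copies of two group actions into one transitive action -/

namespace GluedAction

open MulAction

/-- The left regular action of `B` on the copies of `B` indexed by `T`, together with one fixed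
point `none`. -/
def regularHom (T B : Type*) [Group B] : B →* Equiv.Perm (Option (T × B)) where
  toFun b := Equiv.optionCongr (Equiv.prodCongr (Equiv.refl T) (Equiv.mulLeft b))
  map_one' := by ext (_ | ⟨t, c⟩) <;> simp
  map_mul' b b' := by
    ext1 (_ | ⟨t, c⟩)
    · rfl
    · simp [mul_assoc]

theorem regularHom_some {T B : Type*} [Group B] (b : B) (t : T) (c : B) :
    regularHom T B b (some (t, c)) = some (t, b * c) := rfl

theorem card_fixedBy_regularHom {T B : Type*} [Group B] {b : B} (hb : b ≠ 1) :
    Nat.card (fixedBy (Option (T × B)) (regularHom T B b)) = 1 := by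
  have : fixedBy (Option (T × B)) (regularHom T B b) = {none} := by
    ext (_ | ⟨t, c⟩)
    · exact iff_of_true rfl rfl
    · simp [mem_fixedBy, regularHom_some, hb]
  rw [this, Nat.card_unique]

/-- The action of `A` on the disjoint union of the copies of `X` indexed by `S`. -/
def copiesHom (A S X : Type*) [Group A] [MulAction A X] : A →* Equiv.Perm (S × X) where
  toFun a := Equiv.prodCongr (Equiv.refl S) (toPerm a)
  map_one' := by ext ⟨k, x⟩ <;> simp
  map_mul' a a' := by ext ⟨k, x⟩ <;> simp [mul_smul]

theorem copiesHom_apply {A S X : Type*} [Group A] [MulAction A X] (a : A) (k : S) (x : X) :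
    copiesHom A S X a (k, x) = (k, a • x) := rfl

section

variable {X B : Type*} [Group B] {s : ℕ} {x₀ : X}

open Classical in
/-- Embeds `s` copies of `X` into the union of a point and of `s` times `|X| - 1` copies of `B`. The
points of the `k`-th copy of `X` other than `x₀` go to the neutral elements of the copies of `B`
numbered by `k`; the point `x₀` of the first copy goes to the extra point, and that of any later
copy to the point `c` of a copy of `B` numbered by `k - 1`. This chains everything together. -/
noncomputable def glue (y₀ : {x // x ≠ x₀}) (c : B) (p : Fin s × X) :
    Option ((Fin s × {x // x ≠ x₀}) × B) :=
  if h : p.2 = x₀ then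
    if p.1.val = 0 then none else some ((⟨p.1 - 1, by omega⟩, y₀), c)
  else some ((p.1, ⟨p.2, h⟩), 1)

theorem glue_of_ne (y₀ : {x // x ≠ x₀}) (c : B) (k : Fin s) (x : {x // x ≠ x₀}) :
    glue y₀ c (k, x) = some ((k, x), 1) := dif_neg x.2

theorem glue_zero (y₀ : {x // x ≠ x₀}) (c : B) (hs : 0 < s) : glue y₀ c (⟨0, hs⟩, x₀) = none := by
  simp [glue]

theorem glue_succ (y₀ : {x // x ≠ x₀}) (c : B) (k : ℕ) (hk : k + 1 < s) :
    glue y₀ c (⟨k + 1, hk⟩, x₀) = some ((⟨k, by omega⟩, y₀), c) := by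
  simp [glue]

theorem glue_injective (y₀ : {x // x ≠ x₀}) {c : B} (hc : c ≠ 1) :
    Function.Injective (glue (s := s) y₀ c) := by
  rintro ⟨⟨k, hk⟩, x⟩ ⟨⟨l, hl⟩, y⟩ h
  unfold glue at h
  simp only at h
  split_ifs at h with hx hk0 hy hl0 hy hl0 hy hy
  · simp_all
  · simp_all
    omega
  · simp_all
  · simp_all
  · simp_all

end

/-- Let `X` be a transitive `A`-set and `B` a finite group, both nontrivial. Then `A` and `B` act on
some set of `1 + s (|X| - 1) |B|` elements, together transitively, so that `A` acts as on `s` copies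
of `X` and trivially elsewhere, and `B` acts freely except for one fixed point. -/
theorem exists_perm_homs.{u, v, w} (A : Type u) (B : Type v) (X : Type w) [Group A] [Group B]
    [MulAction A X] [IsPretransitive A X] [Finite B] [Nontrivial B] (hX : 1 < Nat.card X) (s : ℕ) :
    ∃ (Ω : Type (max v w)) (_ : Finite Ω) (α : A →* Equiv.Perm Ω) (β : B →* Equiv.Perm Ω),
      Nat.card Ω = 1 + s * (Nat.card X - 1) * Nat.card B ∧
      (∀ a : A, (∀ x : X, a • x ≠ x) →
        Nat.card (fixedBy Ω (α a)) + s * Nat.card X = Nat.card Ω) ∧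
      (∀ b : B, b ≠ 1 → Nat.card (fixedBy Ω (β b)) = 1) ∧
      ∀ Q : Subgroup (Equiv.Perm Ω), α.range ≤ Q → β.range ≤ Q → IsPretransitive Q Ω := by
  have : Finite X := Nat.finite_of_card_ne_zero (by omega)
  obtain ⟨x₀, y₀, hxy⟩ := Finite.one_lt_card_iff_nontrivial.1 hX
  let y₀ : {x // x ≠ x₀} := ⟨y₀, hxy.symm⟩
  obtain ⟨c, hc⟩ := exists_ne (1 : B)
  let T := Fin s × {x // x ≠ x₀}
  let ι : Fin s × X ↪ Option (T × B) := ⟨glue y₀ c, glue_injective y₀ hc⟩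
  let α : A →* Equiv.Perm (Option (T × B)) :=
    (Equiv.Perm.viaEmbeddingHom ι).comp (copiesHom A (Fin s) X)
  let β := regularHom T B
  have hα : ∀ a k x, α a (glue y₀ c (k, x)) = glue y₀ c (k, a • x) := fun a k x =>
    Equiv.Perm.viaEmbedding_apply (copiesHom A (Fin s) X a) ι (k, x)
  refine ⟨Option (T × B), inferInstance, α, β, ?_, fun a ha => ?_, fun b hb =>
    card_fixedBy_regularHom hb, fun Q hαQ hβQ => ?_⟩
  · have : Nat.card {x // x ≠ x₀} = Nat.card X - 1 := by
      have := Fintype.ofFinite X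
      classical
      rw [Nat.card_eq_fintype_card, Nat.card_eq_fintype_card, Fintype.card_subtype_compl,
        Fintype.card_subtype_eq]
    rw [Finite.card_option, Nat.card_prod, Nat.card_prod, Nat.card_fin, this, add_comm]
  · have hfix : fixedBy (Option (T × B)) (α a) = (Set.range ι)ᶜ := by
      ext z
      constructor
      · rintro hz ⟨⟨k, x⟩, rfl⟩
        have := ι.injective ((hα a k x).symm.trans hz)
        exact ha x (Prod.ext_iff.1 this).2
      · exact fun hz => Equiv.Perm.viaEmbedding_apply_of_notMem _ ι z hz
    have hcard := Set.ncard_add_ncard_compl (Set.range ι)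
    rw [← hfix, ← Nat.card_coe_set_eq, Nat.card_range_of_injective ι.injective, Nat.card_prod,
      Nat.card_fin] at hcard
    rw [Nat.card_coe_set_eq, add_comm, hcard]
  · -- Everything is in the orbit of the extra point, copy by copy.
    let R := orbit Q (none : Option (T × B))
    have hA : ∀ k x y, glue y₀ c (k, x) ∈ R → glue y₀ c (k, y) ∈ R := by
      intro k x y h
      obtain ⟨a, rfl⟩ := exists_smul_eq A x y
      rw [← hα]
      exact mem_orbit_of_mem_orbit (⟨α a, hαQ ⟨a, rfl⟩⟩ : Q) h
    have hB : ∀ t b b', some (t, b) ∈ R → some (t, b') ∈ R := by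
      intro t b b' h
      have : some (t, b') = β (b' * b⁻¹) (some (t, b)) := by
        rw [regularHom_some, inv_mul_cancel_right]
      rw [this]
      exact mem_orbit_of_mem_orbit (⟨β (b' * b⁻¹), hβQ ⟨_, rfl⟩⟩ : Q) h
    have hk : ∀ k (hk : k < s) x, glue y₀ c (⟨k, hk⟩, x) ∈ R := by
      intro k
      induction k with
      | zero =>
        intro hk x
        refine hA _ x₀ _ ?_
        rw [glue_zero]
        exact mem_orbit_self _
      | succ k ih =>
        intro hk x
        refine hA _ x₀ _ ?_
        rw [glue_succ]
        refine hB _ 1 _ ?_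
        rw [← glue_of_ne y₀ c]
        exact ih _ _
    refine (isPretransitive_iff_base (none : Option (T × B))).2 fun z => ?_
    rcases z with _ | ⟨⟨k, x⟩, b⟩
    · exact mem_orbit_self _
    · refine hB _ 1 _ ?_
      rw [← glue_of_ne y₀ c]
      exact hk k k.2 x

end GluedAction

/-! ### Homomorphisms from internal free products -/

namespace IsInternalFreeProduct

variable {P κ : Type*} [Group P] {H : Subgroup P} {B : κ → Subgroup P}

theorem le (h : IsInternalFreeProduct H B) (k : κ) : B k ≤ H := by
  rw [← h.2]
  exact fun x hx => ⟨Monoid.CoprodI.of (⟨x, hx⟩ : B k), by simp⟩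

/-- Homomorphisms from the factors have a common extension. -/
theorem exists_hom (h : IsInternalFreeProduct H B) {M : Type*} [Group M] (f : ∀ k, B k →* M) :
    ∃ π : H →* M, ∀ (k : κ) (x : B k), π ⟨x, h.le k x.2⟩ = f k x := by
  obtain ⟨hinj, rfl⟩ := h
  refine ⟨(Monoid.CoprodI.lift f).comp (MonoidHom.ofInjective hinj).symm.toMonoidHom,
    fun k x => ?_⟩
  have : (MonoidHom.ofInjective hinj) (Monoid.CoprodI.of x) =
      ⟨x, IsInternalFreeProduct.le ⟨hinj, rfl⟩ k x.2⟩ := Subtype.ext (by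
    rw [MonoidHom.ofInjective_apply, Monoid.CoprodI.lift_of, Subgroup.subtype_apply])
  rw [← this]
  simp

/-- Homomorphisms from two factors have a common extension that kills the other factors. -/
theorem exists_hom_of_ne (h : IsInternalFreeProduct H B) {M : Type*} [Group M] {k l : κ}
    (hkl : k ≠ l) (α : B k →* M) (β : B l →* M) :
    ∃ π : H →* M, (∀ x : B k, π ⟨x, h.le k x.2⟩ = α x) ∧ ∀ x : B l, π ⟨x, h.le l x.2⟩ = β x := by
  classical
  obtain ⟨π, hπ⟩ := h.exists_hom (Function.update (Function.update (fun _ => 1) l β) k α)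
  refine ⟨π, fun x => ?_, fun x => ?_⟩
  · rw [hπ, Function.update_self]
  · rw [hπ, Function.update_of_ne hkl.symm, Function.update_self]

end IsInternalFreeProduct

namespace Monoid.CoprodI

variable {ι : Type*} {G : ι → Type*} [∀ i, Group (G i)]

theorem group_fg [Finite ι] [∀ i, Finite (G i)] : Group.FG (Monoid.CoprodI G) := by
  refine Group.fg_iff.2 ⟨⋃ i, Set.range (of : G i →* Monoid.CoprodI G), ?_,
    Set.finite_iUnion fun i => Set.finite_range _⟩
  have h := range_eq_iSup _ (f := fun i => (of : G i →* Monoid.CoprodI G))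
  rw [lift_of', MonoidHom.range_eq_top.2 fun x => ⟨x, rfl⟩] at h
  simp_rw [Subgroup.closure_iUnion, ← MonoidHom.coe_range, Subgroup.closure_eq]
  exact h.symm

theorem pow_mem_commutator [Fintype ι] [∀ i, Finite (G i)] (x : Monoid.CoprodI G) :
    x ^ ∏ i, Nat.card (G i) ∈ commutator (Monoid.CoprodI G) := by
  have : (powMonoidHom (∏ i, Nat.card (G i))).comp
      (Abelianization.of : Monoid.CoprodI G →* _) = 1 := by
    refine ext_hom _ _ fun i => MonoidHom.ext fun y => ?_
    obtain ⟨m, hm⟩ := Finset.dvd_prod_of_mem (fun i => Nat.card (G i)) (Finset.mem_univ i)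
    change Abelianization.of (of y) ^ _ = 1
    rw [← map_pow, ← map_pow, hm, pow_mul, pow_card_eq_one', one_pow, map_one, map_one]
  rw [← Abelianization.ker_of, MonoidHom.mem_ker, map_pow]
  exact DFunLike.congr_fun this x

end Monoid.CoprodI

theorem IsFreeGroup.exists_hom_int (F : Type*) [Group F] [IsFreeGroup F] [Nontrivial F] :
    ∃ (φ : F →* Multiplicative ℤ) (t : F), φ t = Multiplicative.ofAdd 1 := by
  obtain ⟨ι, ⟨b⟩⟩ := IsFreeGroup.nonempty_basis (G := F)
  rcases isEmpty_or_nonempty ι with hι | ⟨⟨i⟩⟩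
  · exact absurd b.repr.injective.subsingleton (not_subsingleton F)
  · exact ⟨(FreeGroup.lift fun _ => Multiplicative.ofAdd 1).comp b.repr.toMonoidHom, b i, by simp⟩

/-! ### Elements of equal order, primes in a progression, and fixed points -/

theorem mem_zpowers_of_orderOf_eq {C : Type*} [Group C] [Finite C] {f u v : C}
    (hu : u ∈ Subgroup.zpowers f) (hv : v ∈ Subgroup.zpowers f) (h : orderOf u = orderOf v) :
    v ∈ Subgroup.zpowers u := by
  classical
  lift u to Subgroup.zpowers f using hu
  lift v to Subgroup.zpowers f using hv
  rw [Subgroup.orderOf_coe, Subgroup.orderOf_coe] at h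
  suffices hvu : v ∈ Subgroup.zpowers u by
    obtain ⟨m, rfl⟩ := hvu
    exact ⟨m, by simp⟩
  have := Fintype.ofFinite (Subgroup.zpowers f)
  have hle := IsCyclic.card_pow_eq_one_le (α := Subgroup.zpowers f) (orderOf_pos u)
  have hsub : (Subgroup.zpowers u : Set (Subgroup.zpowers f)).toFinset ⊆
      Finset.univ.filter fun a => a ^ orderOf u = 1 := by
    intro a ha
    have ha' : a ∈ Subgroup.zpowers u := by simpa using ha
    simpa using orderOf_dvd_iff_pow_eq_one.1 (orderOf_dvd_of_mem_zpowers ha')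
  have heq := Finset.eq_of_subset_of_card_le hsub (hle.trans_eq (by
    rw [Set.toFinset_card, ← Nat.card_eq_fintype_card]
    exact (Nat.card_zpowers u).symm))
  have : v ∈ (Subgroup.zpowers u : Set (Subgroup.zpowers f)).toFinset := by
    rw [heq]
    simp [h, pow_orderOf_eq_one]
  simpa using this

/-- Dirichlet's theorem for the residue class of `1 + n` modulo `n * q`. -/
theorem exists_prime_eq_one_add_mul {n q : ℕ} (hn : n ≠ 0) (hq : q.Prime) (hqn : q ∣ n) :
    ∃ s, s ≡ 1 [MOD q] ∧ (1 + s * n).Prime := by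
  have hcop : (1 + n).Coprime n := by simp
  obtain ⟨m, hm, hmp, hmod⟩ := Nat.forall_exists_prime_gt_and_modEq (1 + n)
    (mul_ne_zero hn hq.ne_zero) (hcop.mul_right (hcop.coprime_dvd_right hqn))
  obtain ⟨l, hl⟩ := (Nat.modEq_iff_dvd' hm.le).1 hmod.symm
  refine ⟨1 + q * l, by simp [Nat.ModEq], ?_⟩
  have : 1 + (1 + q * l) * n = m := by
    rw [Nat.sub_eq_iff_eq_add hm.le] at hl
    rw [hl]
    ring
  rwa [this]

open MulAction

theorem MulAction.card_fixedBy_conj {P Ω : Type*} [Group P] [MulAction P Ω] (x y : P) :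
    Nat.card (fixedBy Ω (y * x * y⁻¹)) = Nat.card (fixedBy Ω x) := by
  rw [← smul_fixedBy]
  exact Nat.card_congr ((MulAction.toPerm y).image (fixedBy Ω x)).symm

theorem Equiv.Perm.card_modEq_card_fixedBy {Z : Type*} [Finite Z] {q : ℕ} (hq : q.Prime)
    {ρ : Equiv.Perm Z} (hρ : ρ ^ q = 1) : Nat.card Z ≡ Nat.card (fixedBy Z ρ) [MOD q] := by
  classical
  have := Fact.mk hq
  have := Fintype.ofFinite Z
  have hpow : (MulAction.toEndHom (α := Z) ρ) ^ q ^ 1 = 1 := by rw [pow_one, ← map_pow, hρ, map_one]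
  have h := Equiv.Perm.card_fixedPoints_modEq hpow
  simp only [← Nat.card_eq_fintype_card] at h
  exact h

/-- If `τ` has exactly one fixed point, and `τ ^ q = 1`, then a permutation `σ` that commutes with
`τ` fixes this point, while `τ` moves the other fixed points of `σ` in cycles of length `q`. -/
theorem Equiv.Perm.card_fixedBy_modEq_one {Ω : Type*} [Finite Ω] {q : ℕ} (hq : q.Prime)
    {σ τ : Equiv.Perm Ω} (h : Commute σ τ) (hτq : τ ^ q = 1)
    (hτ : Nat.card (fixedBy Ω τ) = 1) : Nat.card (fixedBy Ω σ) ≡ 1 [MOD q] := by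
  have hστ : ∀ z, σ (τ z) = τ (σ z) := fun z => DFunLike.congr_fun h.eq z
  have hmem : ∀ z, σ (τ z) = τ z ↔ σ z = z := fun z => by rw [hστ, τ.apply_eq_iff_eq]
  let ρ : Equiv.Perm {z // σ z = z} := τ.subtypePerm hmem
  have hρ : ρ ^ q = 1 := by
    ext z
    simp [ρ, Equiv.Perm.subtypePerm_pow, hτq]
  obtain ⟨⟨w, hw⟩, huniq⟩ := Nat.card_eq_one_iff_exists.1 hτ
  have hw' : ∀ z, τ z = z ↔ z = w := fun z =>
    ⟨fun hz => congrArg Subtype.val (huniq ⟨z, hz⟩), fun hz => hz ▸ hw⟩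
  have hσw : σ w = w := (hw' _).1 (by rw [← hστ, (hw' w).2 rfl])
  have hfix : fixedBy {z // σ z = z} ρ = {⟨w, hσw⟩} := Set.ext fun z => by
    rw [Set.mem_singleton_iff, Subtype.ext_iff, ← hw']
    exact Subtype.ext_iff
  have hmod := Equiv.Perm.card_modEq_card_fixedBy hq hρ
  rw [hfix, Nat.card_coe_set_eq, Set.ncard_singleton] at hmod
  exact hmod

/-! ### Permutation quotients of a verbally closed subgroup with two finite free factors -/

namespace IsVerballyClosed

/-- Let `H` be verbally closed, with finite free factors `B k` and `B l`, and let `X` be a transitive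
`B k`-set. Then the whole group acts on a finite set so that `B l` acts freely except for one fixed
point, while the points that are moved by an element of `B k` acting freely on `X` form `s` copies
of `X`. The action of `H` is put together from those of the factors; it is transitive of prime
degree, and `a` has two fixed points, so that it extends to the whole group. -/
theorem exists_hom_perm.{u, v, w} {P : Type u} {κ : Type w} [Group P] [Group.FG P]
    {H : Subgroup P} {B : κ → Subgroup P} {k l : κ} (hH : IsVerballyClosed H) (hB : IsInternalFreeProduct H B) (hkl : k ≠ l)
    [Finite (B l)] {X : Type v} [MulAction (B k) X] [IsPretransitive (B k) X] [Finite X] [Nonempty X]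
    {q : ℕ} (hq : q.Prime) (hql : q ∣ Nat.card (B l))
    (h2 : ¬ (Nat.card X = 2 ∧ Nat.card (B l) = 2))
    {a : B k} (ha : ∀ x : X, a • x ≠ x) :
    ∃ (Ω : Type (max u v)) (_ : Finite Ω) (Φ : P →* Equiv.Perm Ω) (s : ℕ), s ≡ 1 [MOD q] ∧
      1 < Nat.card (fixedBy Ω (Φ a)) ∧
      Nat.card (fixedBy Ω (Φ a)) + s * Nat.card X =
        1 + s * (Nat.card X - 1) * Nat.card (B l) ∧
      ∀ b : B l, b ≠ 1 → Nat.card (fixedBy Ω (Φ b)) = 1 := by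
  have hX : 1 < Nat.card X :=
    Finite.one_lt_card_iff_nontrivial.2 ⟨_, Classical.arbitrary X, ha _⟩
  have he : 1 < Nat.card (B l) := hq.one_lt.trans_le (Nat.le_of_dvd Nat.card_pos hql)
  have : Nontrivial (B l) := Finite.one_lt_card_iff_nontrivial.1 he
  obtain ⟨s, hs, hprime⟩ := exists_prime_eq_one_add_mul
    (n := (Nat.card X - 1) * Nat.card (B l)) (mul_ne_zero (by omega) (by omega)) hq
    (hql.mul_left _)
  have hs0 : 0 < s := by
    rcases Nat.eq_zero_or_pos s with rfl | h
    · simp [Nat.not_prime_one] at hprime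
    · exact h
  obtain ⟨Ω, _, α, β, hcard, hα, hβ, htrans⟩ := GluedAction.exists_perm_homs (B k) (B l) X hX s
  have hfixa := hα a ha
  -- Fails only for `|X| = |B l| = 2`, and gives `a` more fixed points than `B l` has.
  have hlt : Nat.card X < (Nat.card X - 1) * Nat.card (B l) := by
    obtain ⟨d, hd⟩ := Nat.exists_eq_add_of_le' hX
    rw [hd, Nat.succ_eq_add_one] at h2 ⊢
    rw [show d + (1 + 1) - 1 = d + 1 by omega]
    rcases d with _ | d
    · omega
    · nlinarith
  have hr : 1 < Nat.card (fixedBy Ω (α a)) := by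
    rw [hcard, mul_assoc] at hfixa
    have := Nat.mul_lt_mul_of_pos_left hlt hs0
    omega
  obtain ⟨π, hπa, hπb⟩ := hB.exists_hom_of_ne hkl α β
  have hQ : IsPretransitive π.range Ω := by
    refine htrans _ ?_ ?_
    · rintro _ ⟨x, rfl⟩
      exact ⟨_, hπa x⟩
    · rintro _ ⟨x, rfl⟩
      exact ⟨_, hπb x⟩
  let c : π.range := ⟨α a, _, hπa a⟩
  have hc : c ≠ 1 := by
    intro h
    have h1 : α a = 1 := congrArg Subtype.val h
    have h2 : fixedBy Ω (α a) = Set.univ := by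
      rw [h1]
      exact fixedBy_one_eq_univ Ω _
    rw [h2, Nat.card_univ] at hfixa
    have := Nat.mul_pos hs0 (Nat.zero_lt_of_lt hX)
    omega
  obtain ⟨⟨x, hx⟩, ⟨y, hy⟩, hxy⟩ := Finite.one_lt_card_iff_nontrivial.1 hr
  obtain ⟨Φ, hΦ⟩ := hH.exists_extension
    (exists_not_commute_conj_of_prime_card (Q := π.range) (Ω := Ω) (c := c)
      (by rwa [hcard, mul_assoc]) hc (x := x) (y := y) (fun h => hxy (Subtype.ext h)) hx hy)
    π.rangeRestrict π.rangeRestrict_surjective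
  have hΦπ : ∀ h : H, π.range.subtype (Φ h) = π h := fun h => congrArg Subtype.val (hΦ h)
  have hΦa : π.range.subtype.comp Φ a = α a := (hΦπ ⟨a, hB.le k a.2⟩).trans (hπa a)
  refine ⟨Ω, inferInstance, π.range.subtype.comp Φ, s, hs, ?_, ?_, fun b hb => ?_⟩
  · rwa [hΦa]
  · rw [hΦa, hfixa, hcard]
  · rw [MonoidHom.comp_apply, hΦπ ⟨b, hB.le l b.2⟩, hπb b, hβ b hb]

variable {P κ : Type*} [Group P] [Group.FG P] {H : Subgroup P} {B : κ → Subgroup P} {k l : κ}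

/-- Nontrivial elements of two finite free factors of a verbally closed subgroup are not conjugate
in the whole group. -/
theorem not_isConj_of_ne (hH : IsVerballyClosed H) (hB : IsInternalFreeProduct H B) (hkl : k ≠ l)
    [Finite (B k)] [Finite (B l)] {a : B k} {b : B l} (ha : a ≠ 1) (hb : b ≠ 1) :
    ¬ IsConj (a : P) b := by
  intro hconj
  obtain ⟨y, hy⟩ := isConj_iff.1 hconj
  by_cases h2 : Nat.card (B k) = 2 ∧ Nat.card (B l) = 2
  · -- Here `a * b⁻¹` is a commutator in `P`, but not a product of commutators in `H`.
    have : IsCyclic (B k) := isCyclic_of_prime_card (p := 2) (hp := ⟨Nat.prime_two⟩) h2.1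
    let _ : CommGroup (B k) := IsCyclic.commGroup
    obtain ⟨π, hπa, hπb⟩ := hB.exists_hom_of_ne hkl (MonoidHom.id (B k)) (1 : B l →* B k)
    have h1 := hH.hom_eq_one_of_mem_commutator π
      (⟨a, hB.le k a.2⟩ * ⟨b, hB.le l b.2⟩⁻¹) (by
        have : ((⟨a, hB.le k a.2⟩ * ⟨b, hB.le l b.2⟩⁻¹ : H) : P) = ⁅(a : P), y⁆ := by
          simp [commutatorElement_def, ← hy, mul_assoc]
        rw [this]
        exact Subgroup.commutator_mem_commutator (Subgroup.mem_top _) (Subgroup.mem_top _))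
    rw [map_mul, map_inv, hπa, hπb] at h1
    exact ha (by simpa using h1)
  · have : Nontrivial (B l) := ⟨b, 1, hb⟩
    obtain ⟨q, hq, hql⟩ := Nat.exists_prime_and_dvd (Finite.one_lt_card (α := B l)).ne'
    obtain ⟨Ω, _, Φ, s, -, hr, -, hΦb⟩ := hH.exists_hom_perm hB hkl (X := B k) hq hql h2
      (a := a) (fun x h => ha (mul_eq_right.1 h))
    rw [← card_fixedBy_conj _ (Φ y), ← map_inv, ← map_mul, ← map_mul, hy, hΦb b hb] at hr
    exact lt_irrefl _ hr

/-- Elements of distinct prime orders of two finite free factors of a verbally closed subgroup do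
not commute in the whole group, even after conjugating one of them. -/
theorem not_commute_conj_of_ne (hH : IsVerballyClosed H) (hB : IsInternalFreeProduct H B)
    (hkl : k ≠ l) [Finite (B k)] [Finite (B l)] {p q : ℕ} (hp : p.Prime) (hq : q.Prime)
    (hpq : p ≠ q) {a : B k} {b : B l} (ha : orderOf a = p) (hb : orderOf b = q) (y : P) :
    ¬ Commute (a : P) (y * b * y⁻¹) := by
  intro hcomm
  have := Fact.mk hq
  let C : Sylow q (B k) := default
  have hindex : ¬ q ∣ Nat.card (B k ⧸ (C : Subgroup (B k))) := C.not_dvd_index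
  have hfree : ∀ x : B k ⧸ (C : Subgroup (B k)), a • x ≠ x := by
    intro x
    induction x using QuotientGroup.induction_on with | H x =>
    intro hx
    -- A fixed coset would conjugate `a`, of order `p`, into the `q`-group `C`.
    have hmem : x⁻¹ * a * x ∈ (C : Subgroup (B k)) := by
      rw [mul_assoc]
      exact QuotientGroup.eq.1 hx.symm
    obtain ⟨m, hm⟩ := IsPGroup.iff_orderOf.1 C.isPGroup' ⟨_, hmem⟩
    rw [Subgroup.orderOf_mk] at hm
    have : orderOf (x⁻¹ * a * x) = p := by
      rw [← ha]
      simpa using (MulAut.conj x⁻¹).orderOf_eq a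
    rw [this] at hm
    exact hpq ((Nat.prime_dvd_prime_iff_eq hp hq).1 (hp.dvd_of_dvd_pow hm.dvd))
  have hql : q ∣ Nat.card (B l) := hb ▸ orderOf_dvd_natCard b
  obtain ⟨Ω, _, Φ, s, hs, -, hcount, hΦb⟩ := hH.exists_hom_perm hB hkl hq hql (fun h2 => by
    rw [h2.1] at hindex
    rw [h2.2] at hql
    exact hindex hql) hfree
  have hb1 : b ≠ 1 := fun h => hq.ne_one (by rw [← hb, h, orderOf_one])
  have hΦ : Nat.card (fixedBy Ω (Φ (y * b * y⁻¹))) = 1 := by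
    rw [map_mul, map_mul, map_inv, card_fixedBy_conj, hΦb b hb1]
  have hmod := Equiv.Perm.card_fixedBy_modEq_one hq (hcomm.map Φ) (by
    rw [← map_pow, conj_pow, ← Subgroup.coe_pow, ← hb, pow_orderOf_eq_one]
    simp) hΦ
  -- Modulo `q`, the count of the fixed points of `a` reads `1 + |X| = 1`.
  have hcast := congrArg (Nat.cast : ℕ → ZMod q) hcount
  rw [Nat.cast_add, Nat.cast_add, Nat.cast_mul, Nat.cast_mul _ (Nat.card (B l)),
    (ZMod.natCast_eq_natCast_iff _ _ _).2 hmod, (ZMod.natCast_eq_natCast_iff _ _ _).2 hs,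
    (ZMod.natCast_eq_zero_iff _ _).2 hql] at hcast
  refine hindex ((ZMod.natCast_eq_zero_iff _ _).1 ?_)
  simpa using hcast

end IsVerballyClosed

/-! ### Kurosh decompositions of verbally closed subgroups -/

theorem theorem1 {n : ℕ} (G : Fin n → Type*) [∀ i, Group (G i)] [∀ i, Finite (G i)]
    [∀ i, Nontrivial (G i)] (H F : Subgroup (Monoid.CoprodI G)) {J : Fin n → Type*}
    (K : ∀ i, J i → Subgroup (G i)) (g : ∀ i, J i → Monoid.CoprodI G)
    (hK : ∀ i j, K i j ≠ ⊥) (hdec : IsKuroshDecomposition H F K g)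
    (hH : IsVerballyClosed H) :
    F = ⊥ ∧
      ∀ (i : Fin n) (j₁ j₂ : J i), j₁ ≠ j₂ → ∀ (f x : G i) (k₁ k₂ : ℕ),
        f ^ k₁ ∈ K i j₁ → f ^ k₂ ∈ conjBy (K i j₂) x → f ^ k₁ = 1 ∨ f ^ k₂ = 1 := by
  have hfg : Group.FG (Monoid.CoprodI G) := Monoid.CoprodI.group_fg
  have hB := hdec.freeProduct
  refine ⟨?_, fun i j₁ j₂ hj f x k₁ k₂ h₁ h₂ => ?_⟩
  · by_contra hF
    have : Nontrivial F := (Subgroup.nontrivial_iff_ne_bot F).2 hF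
    have := hdec.free
    obtain ⟨φ, t, ht⟩ := IsFreeGroup.exists_hom_int F
    obtain ⟨π, hπ⟩ := hB.exists_hom (M := Multiplicative ℤ) fun o => match o with
      | none => φ
      | some _ => 1
    -- A power of `t` is a product of commutators, as the abelianization has finite exponent.
    have h1 := hH.hom_eq_one_of_mem_commutator π (⟨t, hB.le none t.2⟩ ^ ∏ i, Nat.card (G i))
      (Monoid.CoprodI.pow_mem_commutator (t : Monoid.CoprodI G))
    rw [map_pow, (hπ none t).trans ht, ← ofAdd_nsmul, ofAdd_eq_one, nsmul_one, Nat.cast_eq_zero,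
      Finset.prod_eq_zero_iff] at h1
    obtain ⟨i, -, hi⟩ := h1
    exact Nat.card_pos.ne' hi
  · set B : Option (Σ i, J i) → Subgroup (Monoid.CoprodI G) :=
      fun o => o.elim F fun p => conjBy ((K p.1 p.2).map Monoid.CoprodI.of) (g p.1 p.2)
    have hne : (some ⟨i, j₁⟩ : Option (Σ i, J i)) ≠ some ⟨i, j₂⟩ := by
      rintro ⟨⟩
      exact hj rfl
    have hfin : ∀ j, Finite (B (some ⟨i, j⟩)) := fun j =>
      (((K i j : Set (G i)).toFinite.image Monoid.CoprodI.of).image (MulAut.conj (g i j))).to_subtype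
    have := hfin j₁
    have := hfin j₂
    let ψ : ∀ j, G i →* Monoid.CoprodI G := fun j =>
      (MulAut.conj (g i j)).toMonoidHom.comp Monoid.CoprodI.of
    have hψ : ∀ j w, ψ j w = g i j * Monoid.CoprodI.of w * (g i j)⁻¹ := fun _ _ => rfl
    have hinj : ∀ j, Function.Injective (ψ j) := fun j =>
      (MulAut.conj (g i j)).injective.comp (Monoid.CoprodI.of_injective i)
    have hmem : ∀ j, ∀ w ∈ K i j, ψ j w ∈ B (some ⟨i, j⟩) := fun j w hw =>
      ⟨Monoid.CoprodI.of w, ⟨w, hw, rfl⟩, rfl⟩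
    have hmem₂ : ∀ v ∈ conjBy (K i j₂) x, x⁻¹ * v * x ∈ K i j₂ := by
      rintro _ ⟨w, hw, rfl⟩
      simpa [mul_assoc] using hw
    -- The factor of `j₂` meets the factor of `j₁` trivially after the conjugation by `y`.
    let y := g i j₁ * Monoid.CoprodI.of x * (g i j₂)⁻¹
    have hy : ∀ v, y * ψ j₂ (x⁻¹ * v * x) * y⁻¹ = ψ j₁ v := fun v => by
      simp only [hψ, y, map_mul, map_inv]
      group
    have hcommon : ∀ w ∈ K i j₁, w ∈ conjBy (K i j₂) x → w = 1 := by
      intro w hw₁ hw₂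
      by_contra hw
      refine hH.not_isConj_of_ne hB hne (a := ⟨_, hmem j₁ w hw₁⟩)
        (b := ⟨_, hmem j₂ _ (hmem₂ w hw₂)⟩) (fun h => hw ?_) (fun h => hw ?_)
        (isConj_iff.2 ⟨y, hy w⟩).symm
      · exact (map_eq_one_iff _ (hinj j₁)).1 (congrArg Subtype.val h)
      · have := (map_eq_one_iff _ (hinj j₂)).1 (congrArg Subtype.val h)
        exact mul_eq_left.1 (mul_eq_one_iff_eq_inv.1 this)
    by_contra! ⟨hf₁, hf₂⟩
    -- Powers of `f ^ k₁` and of `f ^ k₂` of prime orders.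
    obtain ⟨p, hp, hpd⟩ := Nat.exists_prime_and_dvd (mt orderOf_eq_one_iff.1 hf₁)
    obtain ⟨q, hq, hqd⟩ := Nat.exists_prime_and_dvd (mt orderOf_eq_one_iff.1 hf₂)
    set u := (f ^ k₁) ^ (orderOf (f ^ k₁) / p)
    set v := (f ^ k₂) ^ (orderOf (f ^ k₂) / q)
    have hu : orderOf u = p := orderOf_pow_orderOf_div (orderOf_pos _).ne' hpd
    have hv : orderOf v = q := orderOf_pow_orderOf_div (orderOf_pos _).ne' hqd
    have hu₁ : u ∈ K i j₁ := pow_mem h₁ _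
    have hv₂ : v ∈ conjBy (K i j₂) x := pow_mem h₂ _
    by_cases hpq : p = q
    · have hf : f ∈ Subgroup.zpowers f := Subgroup.mem_zpowers f
      have hvu : v ∈ Subgroup.zpowers u := mem_zpowers_of_orderOf_eq (f := f)
        (pow_mem (pow_mem hf _) _) (pow_mem (pow_mem hf _) _) (by rw [hu, hv, hpq])
      have hv1 := hcommon v (Subgroup.zpowers_le.2 hu₁ hvu) hv₂
      rw [hv1, orderOf_one] at hv
      exact hq.ne_one hv.symm
    · refine hH.not_commute_conj_of_ne hB hne hp hq hpq (a := ⟨_, hmem j₁ u hu₁⟩)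
        (b := ⟨_, hmem j₂ _ (hmem₂ v hv₂)⟩) ?_ ?_ y ?_
      · rw [Subgroup.orderOf_mk, orderOf_injective _ (hinj j₁), hu]
      · rw [Subgroup.orderOf_mk, orderOf_injective _ (hinj j₂), ← hv]
        simpa using (MulAut.conj x⁻¹).orderOf_eq v
      · change Commute (ψ j₁ u) (y * ψ j₂ (x⁻¹ * v * x) * y⁻¹)
        rw [hy]
        exact ((((Commute.refl f).pow_pow k₁ k₂).pow_pow _ _).map (ψ j₁))
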